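/- For $n\in\mathbb N$, a real quadratic form $\Phi$ on $\mathbb C^n\simeq\mathbb R^{2n}$ is called strictly plurisubharmonic if $\sum_{k,\ell=1}^n \frac{\partial^2\Phi(x)}{\partial x_k\partial\overline{x}_\ell}\,\zeta_k\overline{\zeta}_\ell>0$ for all $x\in\mathbb C^n$ and all $0\neq\zeta\in\mathbb C^n$. Its Bargmann space is $H_\Phi(\mathbb C^n)=\mathrm{Hol}(\mathbb C^n)\cap L^2(\mathbb C^n,e^{-2\Phi}L(dx))$, where $\mathrm{Hol}(\mathbb C^n)$ is the space of entire holomorphic functions and $L(dx)$ is Lebesgue measure, with the norm of $L^2(\mathbb C^n,e^{-2\Phi}L(dx))$. Theorem. Let $\Phi_1$, $\Phi_2$ be strictly plurisubharmonic quadratic forms on $\mathbb C^{n_1}$, $\mathbb C^{n_2}$, respectively, let $\varphi:\mathbb C^{n_2}\to\mathbb C^{n_1}$ be a holomorphic map, and set $C_\varphi u=u\circ\varphi$ for $u:\mathbb C^{n_1}\to\mathbb C$ holomorphic. Then $C_\varphi$ maps $H_{\Phi_1}(\mathbb C^{n_1})$ into $H_{\Phi_2}(\mathbb C^{n_2})$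 and is a bounded operator between these spaces if and only if the following three conditions are satisfied: (i) there exist a complex $n_1\times n_2$ matrix $A$ and $b\in\mathbb C^{n_1}$ such that $\varphi(x)=Ax+b$ for all $x\in\mathbb C^{n_2}$; (ii) the matrix $A$ in (i) satisfies $Ax\neq 0$ for every $0\neq x\in\mathbb C^{n_2}$ with $\Phi_2(x)\leq 0$; (iii) $e^{\Phi_1\circ\varphi-\Phi_2}\in L^\infty(\mathbb C^{n_2})$. -/

import Mathlib

open MeasureTheory
open scoped ENNReal NNReal Matrix

noncomputable section

namespace Bargmann

/-- The Wirtinger derivative `∂_{x_j} = (∂_{Re x_j} - i ∂_{Im x_j}) / 2` on `ℂⁿ`. -/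
def wirtinger {n : ℕ} (j : Fin n) (f : (Fin n → ℂ) → ℂ) (x : Fin n → ℂ) : ℂ :=
  (1 / 2 : ℂ) * (fderiv ℝ f x (Pi.single j 1) - Complex.I * fderiv ℝ f x (Pi.single j Complex.I))

/-- The Wirtinger derivative `∂_{x̄_j} = (∂_{Re x_j} + i ∂_{Im x_j}) / 2` on `ℂⁿ`. -/
def wirtingerBar {n : ℕ} (j : Fin n) (f : (Fin n → ℂ) → ℂ) (x : Fin n → ℂ) : ℂ :=
  (1 / 2 : ℂ) * (fderiv ℝ f x (Pi.single j 1) + Complex.I * fderiv ℝ f x (Pi.single j Complex.I))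

/-- The Levi form `∑ (∂²Φ / ∂x_k ∂x̄_ℓ)(x) ζ_k ζ̄_ℓ` of a real-valued function on `ℂⁿ`. -/
def leviForm {n : ℕ} (Φ : (Fin n → ℂ) → ℝ) (x ζ : Fin n → ℂ) : ℂ :=
  ∑ k, ∑ l, wirtinger k (wirtingerBar l (fun y => (Φ y : ℂ))) x * ζ k * starRingEnd ℂ (ζ l)

/-- A real quadratic form on `ℂⁿ ≃ ℝ²ⁿ` is strictly plurisubharmonic when its Levi form (which is
real-valued) is positive definite at each point. -/
def StrictlyPlurisubharmonic {n : ℕ} (Φ : QuadraticForm ℝ (Fin n → ℂ)) : Prop :=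
  ∀ x ζ : Fin n → ℂ, ζ ≠ 0 → 0 < (leviForm Φ x ζ).re

/-- The measure `e^{-2Φ} L(dx)` on `ℂⁿ`, with `L(dx)` the Lebesgue measure. -/
def weightedMeasure {n : ℕ} (Φ : (Fin n → ℂ) → ℝ) : Measure (Fin n → ℂ) :=
  (volume : Measure (Fin n → ℂ)).withDensity fun x => ENNReal.ofReal (Real.exp (-2 * Φ x))

/-- The Bargmann space `H_Φ(ℂⁿ) = Hol(ℂⁿ) ∩ L²(ℂⁿ, e^{-2Φ} L(dx))`. -/
def bargmannSpace {n : ℕ} (Φ : (Fin n → ℂ) → ℝ) : Submodule ℂ ((Fin n → ℂ) → ℂ) where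
  carrier := {u | Differentiable ℂ u ∧ MemLp u 2 (weightedMeasure Φ)}
  add_mem' hu hv := ⟨hu.1.add hv.1, hu.2.add hv.2⟩
  zero_mem' := ⟨differentiable_const 0, MemLp.zero⟩
  smul_mem' c _ hu := ⟨hu.1.const_smul c, hu.2.const_smul c⟩

/-- The pullback (composition) operator `C_φ u = u ∘ φ`. -/
def pullback {n₁ n₂ : ℕ} (φ : (Fin n₂ → ℂ) → (Fin n₁ → ℂ)) (u : (Fin n₁ → ℂ) → ℂ) :
    (Fin n₂ → ℂ) → ℂ :=
  u ∘ φ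

/-- `C_φ` is a bounded operator `H_{Φ₁}(ℂ^{n₁}) → H_{Φ₂}(ℂ^{n₂})`: it maps the first space into the
second one, and it is bounded for the weighted `L²` norms. -/
def PullbackIsBounded {n₁ n₂ : ℕ} (Φ₁ : (Fin n₁ → ℂ) → ℝ) (Φ₂ : (Fin n₂ → ℂ) → ℝ)
    (φ : (Fin n₂ → ℂ) → (Fin n₁ → ℂ)) : Prop :=
  (∀ u ∈ bargmannSpace Φ₁, pullback φ u ∈ bargmannSpace Φ₂) ∧
    ∃ C : ℝ≥0, ∀ u ∈ bargmannSpace Φ₁,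
      eLpNorm (pullback φ u) 2 (weightedMeasure Φ₂) ≤ C * eLpNorm u 2 (weightedMeasure Φ₁)

end Bargmann

end

/-! Split `Φ = L + Re q` with `q` a holomorphic quadratic form and `L` Hermitian, positive definite
by strict plurisubharmonicity. Multiplication by `exp (-q)` and a further holomorphic factor turns
the weight into a Gaussian centred anywhere. This gives a sub-mean value estimate uniform in the
centre (`exists_ofReal_weightedSq_le`) and coherent states whose norm does not depend on their
centre.

Necessity: testing `C_φ` on the coherent state at `φ y` and estimating at `y` bounds `Φ₁ ∘ φ - Φ₂`.
Averaging this bound over balls centred at 0 replaces `Re (q₁ ∘ φ)` by its value at 0, so positivity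
of `L₁` forces linear growth of `φ`, and Liouville makes `φ` affine. If `A v = 0` with `v ≠ 0` and
`Φ₂ v ≤ 0`, then `Φ₂` is constant along `v`, and no nonzero `u ∘ φ` is square integrable.

Sufficiency: the density of `u ∘ φ` is `exp (2 (Φ₁ ∘ φ - Φ₂))` times that of `u` at `φ x`.
Dominating the latter by its integral over the unit ball at `φ x` and applying Tonelli leaves a
bound on the integral of the exponential over `φ⁻¹(B(y, 1))`, uniform in `y`
(`exists_setLIntegral_exp_le`). -/

namespace Bargmann

open QuadraticMap

variable {n n₁ n₂ : ℕ}

/-! ### Splitting a real quadratic form into Hermitian and pluriharmonic parts. -/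

/-- The polar form of a real quadratic form on `ℂⁿ`, as a continuous real bilinear map. -/
noncomputable def polarCLM (Φ : QuadraticForm ℝ (Fin n → ℂ)) :
    (Fin n → ℂ) →L[ℝ] (Fin n → ℂ) →L[ℝ] ℝ :=
  (polarBilin Φ).toContinuousBilinearMap

theorem polarCLM_apply (Φ : QuadraticForm ℝ (Fin n → ℂ)) (x y : Fin n → ℂ) :
    polarCLM Φ x y = polar Φ x y := rfl

theorem quadraticForm_eq_half_polar (Φ : QuadraticForm ℝ (Fin n → ℂ)) (x : Fin n → ℂ) :
    Φ x = (1 / 2) * polarCLM Φ x x := by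
  rw [polarCLM_apply, polar_self]; simp

theorem hasFDerivAt_quadraticForm (Φ : QuadraticForm ℝ (Fin n → ℂ)) (x : Fin n → ℂ) :
    HasFDerivAt Φ (polarCLM Φ x) x := by
  have h1 : HasFDerivAt (fun y => (1 / 2 : ℝ) * polarCLM Φ y y)
      ((1 / 2 : ℝ) • ((polarCLM Φ).precompR _ x (ContinuousLinearMap.id ℝ _) +
        (polarCLM Φ).precompL _ (ContinuousLinearMap.id ℝ _) x)) x :=
    ((polarCLM Φ).hasFDerivAt_of_bilinear (hasFDerivAt_id x) (hasFDerivAt_id x)).const_mul _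
  have h2 : (Φ : (Fin n → ℂ) → ℝ) = fun y => (1 / 2 : ℝ) * polarCLM Φ y y :=
    funext (quadraticForm_eq_half_polar Φ)
  rw [h2]
  refine h1.congr_fderiv (ContinuousLinearMap.ext fun v => ?_)
  simp [polarCLM_apply, polar_comm Φ v x]
  ring

theorem continuous_quadraticForm (Φ : QuadraticForm ℝ (Fin n → ℂ)) : Continuous Φ :=
  continuous_iff_continuousAt.2 fun x => (hasFDerivAt_quadraticForm Φ x).continuousAt

/-- The Hermitian form of a real quadratic form `Φ` on `ℂⁿ`, `ℂ`-linear in its argument. -/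
noncomputable def hermitianPart (Φ : QuadraticForm ℝ (Fin n → ℂ)) (y : Fin n → ℂ) :
    (Fin n → ℂ) →ₗ[ℂ] ℂ where
  toFun x := (1 / 4 : ℂ) * ((polar Φ x y + polar Φ (Complex.I • x) (Complex.I • y)) +
    Complex.I * (polar Φ x (Complex.I • y) - polar Φ (Complex.I • x) y))
  map_add' x x' := by
    simp only [smul_add, polar_add_left]; push_cast; ring
  map_smul' c x := by
    have h : ∀ x : Fin n → ℂ, c • x = c.re • x + c.im • (Complex.I • x) := by
      intro x; ext j
      simp only [Pi.smul_apply, Pi.add_apply, smul_eq_mul, Complex.real_smul]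
      conv_lhs => rw [← Complex.re_add_im c]
      ring
    have hI : Complex.I • Complex.I • x = -x := by rw [smul_smul]; simp
    rw [smul_comm Complex.I c x, h x, h (Complex.I • x)]
    simp only [hI, polar_add_left, polar_smul_left, polar_neg_left, smul_eq_mul, RingHom.id_apply]
    conv_rhs => rw [← Complex.re_add_im c]
    push_cast
    ring_nf
    simp only [Complex.I_sq]
    ring

/-- The `ℂ`-bilinear part of a real quadratic form `Φ` on `ℂⁿ`. -/
noncomputable def bilinearPart (Φ : QuadraticForm ℝ (Fin n → ℂ)) (y : Fin n → ℂ) :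
    (Fin n → ℂ) →ₗ[ℂ] ℂ where
  toFun x := (1 / 4 : ℂ) * ((polar Φ x y - polar Φ (Complex.I • x) (Complex.I • y)) -
    Complex.I * (polar Φ x (Complex.I • y) + polar Φ (Complex.I • x) y))
  map_add' x x' := by
    simp only [smul_add, polar_add_left]; push_cast; ring
  map_smul' c x := by
    have h : ∀ x : Fin n → ℂ, c • x = c.re • x + c.im • (Complex.I • x) := by
      intro x; ext j
      simp only [Pi.smul_apply, Pi.add_apply, smul_eq_mul, Complex.real_smul]
      conv_lhs => rw [← Complex.re_add_im c]
      ring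
    have hI : Complex.I • Complex.I • x = -x := by rw [smul_smul]; simp
    rw [smul_comm Complex.I c x, h x, h (Complex.I • x)]
    simp only [hI, polar_add_left, polar_smul_left, polar_neg_left, smul_eq_mul, RingHom.id_apply]
    conv_rhs => rw [← Complex.re_add_im c]
    push_cast
    ring_nf
    simp only [Complex.I_sq]
    ring

theorem hermitianPart_apply (Φ : QuadraticForm ℝ (Fin n → ℂ)) (x y : Fin n → ℂ) :
    hermitianPart Φ y x =
      (1 / 4 : ℂ) * ((polar Φ x y + polar Φ (Complex.I • x) (Complex.I • y)) +
        Complex.I * (polar Φ x (Complex.I • y) - polar Φ (Complex.I • x) y)) := rfl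

theorem bilinearPart_apply (Φ : QuadraticForm ℝ (Fin n → ℂ)) (x y : Fin n → ℂ) :
    bilinearPart Φ y x =
      (1 / 4 : ℂ) * ((polar Φ x y - polar Φ (Complex.I • x) (Complex.I • y)) -
        Complex.I * (polar Φ x (Complex.I • y) + polar Φ (Complex.I • x) y)) := rfl

theorem hermitianPart_conj (Φ : QuadraticForm ℝ (Fin n → ℂ)) (x y : Fin n → ℂ) :
    starRingEnd ℂ (hermitianPart Φ y x) = hermitianPart Φ x y := by
  simp only [hermitianPart_apply, map_mul, map_add, map_sub, Complex.conj_ofReal, Complex.conj_I,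
    map_div₀, map_one, Complex.conj_ofNat]
  rw [polar_comm Φ y x, polar_comm Φ (Complex.I • y) (Complex.I • x),
    polar_comm Φ y (Complex.I • x), polar_comm Φ (Complex.I • y) x]
  ring

theorem bilinearPart_comm (Φ : QuadraticForm ℝ (Fin n → ℂ)) (x y : Fin n → ℂ) :
    bilinearPart Φ y x = bilinearPart Φ x y := by
  simp only [bilinearPart_apply]
  rw [polar_comm Φ y x, polar_comm Φ (Complex.I • y) (Complex.I • x),
    polar_comm Φ y (Complex.I • x), polar_comm Φ (Complex.I • y) x]
  ring

/-- The Levi form of a real quadratic form on `ℂⁿ`, as a real-valued function: its average under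
multiplication by `i`. -/
noncomputable def leviPart (Φ : QuadraticForm ℝ (Fin n → ℂ)) (x : Fin n → ℂ) : ℝ :=
  (Φ x + Φ (Complex.I • x)) / 2

/-- The holomorphic quadratic form `q` such that `Φ = leviPart Φ + Re q`. -/
noncomputable def holomorphicPart (Φ : QuadraticForm ℝ (Fin n → ℂ)) (x : Fin n → ℂ) : ℂ :=
  bilinearPart Φ x x

theorem hermitianPart_self (Φ : QuadraticForm ℝ (Fin n → ℂ)) (x : Fin n → ℂ) :
    hermitianPart Φ x x = (leviPart Φ x : ℂ) := by
  rw [hermitianPart_apply, leviPart, polar_comm Φ (Complex.I • x) x, polar_self, polar_self]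
  simp only [nsmul_eq_mul]
  push_cast
  ring

theorem re_holomorphicPart (Φ : QuadraticForm ℝ (Fin n → ℂ)) (x : Fin n → ℂ) :
    (holomorphicPart Φ x).re = (Φ x - Φ (Complex.I • x)) / 2 := by
  have h : holomorphicPart Φ x = (((Φ x - Φ (Complex.I • x)) / 2 : ℝ) : ℂ) +
      ((-(polar Φ x (Complex.I • x)) / 2 : ℝ) : ℂ) * Complex.I := by
    rw [holomorphicPart, bilinearPart_apply, polar_comm Φ (Complex.I • x) x, polar_self, polar_self]
    simp only [nsmul_eq_mul]
    push_cast
    ring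
  rw [h]; simp

theorem leviPart_add_re_holomorphicPart (Φ : QuadraticForm ℝ (Fin n → ℂ)) (x : Fin n → ℂ) :
    leviPart Φ x + (holomorphicPart Φ x).re = Φ x := by
  rw [re_holomorphicPart, leviPart]; ring

theorem re_hermitianPart (Φ : QuadraticForm ℝ (Fin n → ℂ)) (x y : Fin n → ℂ) :
    (hermitianPart Φ y x).re =
      (polar Φ x y + polar Φ (Complex.I • x) (Complex.I • y)) / 4 := by
  have h : hermitianPart Φ y x =
      (((polar Φ x y + polar Φ (Complex.I • x) (Complex.I • y)) / 4 : ℝ) : ℂ) +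
      (((polar Φ x (Complex.I • y) - polar Φ (Complex.I • x) y) / 4 : ℝ) : ℂ) * Complex.I := by
    rw [hermitianPart_apply]; push_cast; ring
  rw [h]; simp

theorem leviPart_add (Φ : QuadraticForm ℝ (Fin n → ℂ)) (x y : Fin n → ℂ) :
    leviPart Φ (x + y) = leviPart Φ x + 2 * (hermitianPart Φ y x).re + leviPart Φ y := by
  rw [re_hermitianPart, leviPart, leviPart, leviPart, smul_add, polar, polar]; ring

theorem leviPart_smul (Φ : QuadraticForm ℝ (Fin n → ℂ)) (t : ℝ) (x : Fin n → ℂ) :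
    leviPart Φ (t • x) = t ^ 2 * leviPart Φ x := by
  rw [leviPart, leviPart, smul_comm, QuadraticMap.map_smul, QuadraticMap.map_smul, smul_eq_mul,
    smul_eq_mul]; ring

theorem leviPart_sub (Φ : QuadraticForm ℝ (Fin n → ℂ)) (x y : Fin n → ℂ) :
    leviPart Φ (x - y) = leviPart Φ x - 2 * (hermitianPart Φ y x).re + leviPart Φ y := by
  have h := leviPart_add Φ (x - y) y
  rw [map_sub, Complex.sub_re, hermitianPart_self, Complex.ofReal_re, sub_add_cancel] at h
  linarith

theorem continuous_leviPart (Φ : QuadraticForm ℝ (Fin n → ℂ)) : Continuous (leviPart Φ) := by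
  have := continuous_quadraticForm Φ
  unfold leviPart
  fun_prop

theorem differentiable_linearMap (f : (Fin n → ℂ) →ₗ[ℂ] ℂ) : Differentiable ℂ f :=
  (LinearMap.toContinuousLinearMap f).differentiable

theorem differentiable_holomorphicPart (Φ : QuadraticForm ℝ (Fin n → ℂ)) :
    Differentiable ℂ (holomorphicPart Φ) := by
  -- By symmetry of the bilinear part, the coefficient of `x k` is itself complex linear in `x`.
  have h : holomorphicPart Φ =
      fun x => ∑ k, x k * bilinearPart Φ (Pi.single k 1) x := by
    funext x
    rw [holomorphicPart, LinearMap.pi_apply_eq_sum_univ (bilinearPart Φ x) x]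
    refine Finset.sum_congr rfl fun k _ => ?_
    rw [smul_eq_mul, ← bilinearPart_comm]
    congr 3
    ext i; simp [Pi.single_apply, eq_comm]
  rw [h]
  refine Differentiable.fun_sum fun k _ => ?_
  exact (differentiable_apply k).mul (differentiable_linearMap _)

/-! ### Identification of the Levi form. -/

theorem wirtingerBar_quadraticForm (Φ : QuadraticForm ℝ (Fin n → ℂ)) (l : Fin n)
    (x : Fin n → ℂ) :
    wirtingerBar l (fun y => (Φ y : ℂ)) x =
      (1 / 2 : ℂ) * (polar Φ x (Pi.single l 1) + Complex.I * polar Φ x (Pi.single l Complex.I)) := by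
  have h : HasFDerivAt (fun y => (Φ y : ℂ)) (Complex.ofRealCLM.comp (polarCLM Φ x)) x :=
    Complex.ofRealCLM.hasFDerivAt.comp x (hasFDerivAt_quadraticForm Φ x)
  rw [wirtingerBar, h.fderiv]
  rfl

theorem wirtinger_wirtingerBar_quadraticForm (Φ : QuadraticForm ℝ (Fin n → ℂ)) (k l : Fin n)
    (x : Fin n → ℂ) :
    wirtinger k (wirtingerBar l (fun y => (Φ y : ℂ))) x =
      hermitianPart Φ (Pi.single l 1) (Pi.single k 1) := by
  have hs : ∀ j : Fin n, (Pi.single j Complex.I : Fin n → ℂ) = Complex.I • Pi.single j 1 := by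
    intro j; rw [← Pi.single_smul]; simp
  have h (v : Fin n → ℂ) :
      HasFDerivAt (fun y => ((polar Φ y v : ℝ) : ℂ))
        (Complex.ofRealCLM.comp ((polarCLM Φ).flip v)) x :=
    (Complex.ofRealCLM.comp ((polarCLM Φ).flip v)).hasFDerivAt
  have h1 := ((h (Pi.single l 1)).add ((h (Pi.single l Complex.I)).const_mul Complex.I)).const_mul
    (1 / 2 : ℂ)
  rw [funext (wirtingerBar_quadraticForm Φ l), wirtinger]
  have h2 := h1.fderiv
  simp only [Pi.add_def] at h2
  rw [h2, hermitianPart_apply]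
  simp only [_root_.smul_apply, _root_.add_apply,
    ContinuousLinearMap.comp_apply, ContinuousLinearMap.flip_apply, polarCLM_apply,
    Complex.ofRealCLM_apply, smul_eq_mul, hs]
  ring_nf
  simp only [Complex.I_sq]
  ring

theorem leviForm_quadraticForm (Φ : QuadraticForm ℝ (Fin n → ℂ)) (x ζ : Fin n → ℂ) :
    leviForm Φ x ζ = (leviPart Φ ζ : ℂ) := by
  have hsum (y z : Fin n → ℂ) : ∑ k, hermitianPart Φ y (Pi.single k 1) * z k =
      hermitianPart Φ y z := by
    rw [LinearMap.pi_apply_eq_sum_univ (hermitianPart Φ y) z]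
    refine Finset.sum_congr rfl fun k _ => ?_
    rw [smul_eq_mul, mul_comm]
    congr 2
    ext i; simp [Pi.single_apply, eq_comm]
  simp only [leviForm, wirtinger_wirtingerBar_quadraticForm]
  rw [Finset.sum_comm]
  simp only [← Finset.sum_mul, hsum]
  -- Hermitian symmetry turns the antilinear slot into a linear one, so `hsum` applies a second
  -- time.
  have hconj (l : Fin n) : hermitianPart Φ (Pi.single l 1) ζ * starRingEnd ℂ (ζ l) =
      starRingEnd ℂ (hermitianPart Φ ζ (Pi.single l 1) * ζ l) := by
    rw [map_mul, hermitianPart_conj]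
  simp only [hconj]
  rw [← map_sum, hsum, hermitianPart_self, Complex.conj_ofReal]

theorem StrictlyPlurisubharmonic.leviPart_pos {Φ : QuadraticForm ℝ (Fin n → ℂ)}
    (hΦ : StrictlyPlurisubharmonic Φ) {x : Fin n → ℂ} (hx : x ≠ 0) : 0 < leviPart Φ x := by
  have := hΦ 0 x hx
  rwa [leviForm_quadraticForm, Complex.ofReal_re] at this

/-! ### Homogeneous functions against the squared norm, and Gaussian integrability. -/

theorem exists_le_mul_sq_norm {P : (Fin n → ℂ) → ℝ} (hc : Continuous P)
    (hP : ∀ (t : ℝ) x, P (t • x) = t ^ 2 * P x) : ∃ M, 0 ≤ M ∧ ∀ x, P x ≤ M * ‖x‖ ^ 2 := by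
  obtain ⟨M, hM⟩ := (isCompact_sphere (0 : Fin n → ℂ) 1).bddAbove_image hc.continuousOn
  refine ⟨max M 0, le_max_right _ _, fun x => ?_⟩
  rcases eq_or_ne x 0 with rfl | hx
  · have := hP 0 0
    simp at this; simp [this]
  have hx' : ‖x‖ ≠ 0 := norm_ne_zero_iff.2 hx
  have h1 : P (‖x‖⁻¹ • x) ≤ M :=
    hM ⟨_, by simp [norm_smul, inv_mul_cancel₀ hx'], rfl⟩
  have h2 : P x = ‖x‖ ^ 2 * P (‖x‖⁻¹ • x) := by
    rw [← hP, smul_smul, mul_inv_cancel₀ hx', one_smul]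
  rw [h2, mul_comm]
  exact mul_le_mul_of_nonneg_right (h1.trans (le_max_left _ _)) (by positivity)

theorem exists_mul_sq_norm_le {P : (Fin n → ℂ) → ℝ} (hc : Continuous P)
    (hP : ∀ (t : ℝ) x, P (t • x) = t ^ 2 * P x) (hpos : ∀ x, x ≠ 0 → 0 < P x) :
    ∃ δ, 0 < δ ∧ ∀ x, δ * ‖x‖ ^ 2 ≤ P x := by
  have h0 : P 0 = 0 := by simpa using hP 0 0
  -- The sphere is empty only when `n = 0`; any `δ` then works.
  rcases (Metric.sphere (0 : Fin n → ℂ) 1).eq_empty_or_nonempty with he | hne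
  · refine ⟨1, one_pos, fun x => ?_⟩
    rcases eq_or_ne x 0 with rfl | hx
    · simp [h0]
    have hx' : ‖x‖ ≠ 0 := norm_ne_zero_iff.2 hx
    have : ‖x‖⁻¹ • x ∈ Metric.sphere (0 : Fin n → ℂ) 1 := by
      simp [norm_smul, inv_mul_cancel₀ hx']
    rw [he] at this; exact this.elim
  obtain ⟨a, ha, hmin⟩ := (isCompact_sphere (0 : Fin n → ℂ) 1).exists_isMinOn hne hc.continuousOn
  refine ⟨P a, hpos a (Metric.ne_of_mem_sphere ha one_ne_zero), fun x => ?_⟩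
  rcases eq_or_ne x 0 with rfl | hx
  · simp [h0]
  have hx' : ‖x‖ ≠ 0 := norm_ne_zero_iff.2 hx
  have h1 : P a ≤ P (‖x‖⁻¹ • x) := hmin (by simp [norm_smul, inv_mul_cancel₀ hx'])
  have h2 : P x = ‖x‖ ^ 2 * P (‖x‖⁻¹ • x) := by
    rw [← hP, smul_smul, mul_inv_cancel₀ hx', one_smul]
  rw [h2, mul_comm]
  exact mul_le_mul_of_nonneg_left h1 (by positivity)

theorem integrable_exp_neg_mul_sq_norm {δ : ℝ} (hδ : 0 < δ) :
    Integrable (fun x : Fin n → ℂ => Real.exp (-δ * ‖x‖ ^ 2)) := by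
  -- The norm is the sup norm, so `∑ ‖x i‖ ^ 2 ≤ n * ‖x‖ ^ 2`; dividing by `n + 1` also covers `n =
  -- 0`.
  have hδ' : 0 < δ / (n + 1) := by positivity
  have h1 : Integrable (fun z : ℂ => Real.exp (-(δ / (n + 1)) * ‖z‖ ^ 2)) := by
    have := GaussianFourier.integrable_cexp_neg_mul_sq_norm_add (V := ℂ)
      (b := ((δ / (n + 1) : ℝ) : ℂ)) (by rw [Complex.ofReal_re]; exact hδ') 0 0
    refine this.norm.congr (Filter.Eventually.of_forall fun z => ?_)
    simp only [Complex.norm_exp]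
    congr 1
    have : (-((δ / (n + 1) : ℝ) : ℂ) * (‖z‖ : ℂ) ^ 2 + 0 * ((inner ℝ (0 : ℂ) z : ℝ) : ℂ)) =
      ((-(δ / (n + 1)) * ‖z‖ ^ 2 : ℝ) : ℂ) := by push_cast; ring
    rw [this, Complex.ofReal_re]
  have h2 := Integrable.fintype_prod (μ := fun _ : Fin n => (volume : Measure ℂ))
    (f := fun _ z => Real.exp (-(δ / (n + 1)) * ‖z‖ ^ 2)) fun _ => h1
  refine Integrable.mono' h2 (by fun_prop) (Filter.Eventually.of_forall fun x => ?_)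
  rw [Real.norm_eq_abs, Real.abs_exp, ← Real.exp_sum, Real.exp_le_exp, ← Finset.mul_sum]
  have h3 : ∑ i, ‖x i‖ ^ 2 ≤ n * ‖x‖ ^ 2 := by
    calc ∑ i, ‖x i‖ ^ 2 ≤ ∑ _i : Fin n, ‖x‖ ^ 2 :=
          Finset.sum_le_sum fun i _ => by gcongr; exact norm_le_pi_norm x i
      _ = n * ‖x‖ ^ 2 := by simp
  have h4 : δ / (n + 1) * ∑ i, ‖x i‖ ^ 2 ≤ δ / (n + 1) * ((n + 1) * ‖x‖ ^ 2) := by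
    gcongr; nlinarith [sq_nonneg ‖x‖]
  have h5 : δ / (n + 1) * ((n + 1) * ‖x‖ ^ 2) = δ * ‖x‖ ^ 2 := by field_simp
  linarith

/-! ### Mean value property of entire functions. -/

theorem measurePreserving_rotation (c : Circle) :
    MeasurePreserving (fun x : Fin n → ℂ => (c : ℂ) • x) := by
  have h : MeasurePreserving (fun z : ℂ => (c : ℂ) * z) := (rotation c).measurePreserving
  exact volume_preserving_pi fun _ : Fin n => h

/-- The mean value property on balls centred at the origin. -/
theorem setIntegral_closedBall_eq {h : (Fin n → ℂ) → ℂ} (hh : Differentiable ℂ h) (R : ℝ) :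
    ∫ x in Metric.closedBall 0 R, h x =
      (volume.real (Metric.closedBall (0 : Fin n → ℂ) R) : ℂ) * h 0 := by
  set B := Metric.closedBall (0 : Fin n → ℂ) R
  -- Scalar rotations preserve the ball, so the integral may be averaged over `θ`; after Fubini each
  -- inner circle mean is `h 0`.
  have hrot (θ : ℝ) : ∫ x in B, h (circleMap 0 1 θ • x) = ∫ x in B, h x := by
    have hpre : (fun x : Fin n → ℂ => (Circle.exp θ : ℂ) • x) ⁻¹' B = B := by
      ext x; simp [B, norm_smul]
    have hemb : MeasurableEmbedding (fun x : Fin n → ℂ => (Circle.exp θ : ℂ) • x) :=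
      (Homeomorph.smulOfNeZero (Circle.exp θ : ℂ) (Circle.coe_ne_zero _)).measurableEmbedding
    have h1 := (measurePreserving_rotation (n := n) (Circle.exp θ)).setIntegral_preimage_emb
      hemb h B
    rw [hpre] at h1
    rw [← h1]
    simp [circleMap]
  have hcirc (x : Fin n → ℂ) : ∫ θ in 0..2 * Real.pi, h (circleMap 0 1 θ • x) =
      (2 * Real.pi : ℝ) • h 0 := by
    have hd : Differentiable ℂ (fun z : ℂ => h (z • x)) :=
      hh.comp (differentiable_id.smul_const x)
    have h1 := hd.diffContOnCl (s := Metric.ball 0 |1|) |>.circleAverage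
    rw [Real.circleAverage, inv_smul_eq_iff₀ (by positivity)] at h1
    rw [h1, zero_smul]
  have hint : Integrable (Function.uncurry fun (θ : ℝ) (x : Fin n → ℂ) => h (circleMap 0 1 θ • x))
      ((volume.restrict (Set.uIoc 0 (2 * Real.pi))).prod (volume.restrict B)) := by
    rw [Measure.prod_restrict]
    have hc : Continuous
        (Function.uncurry fun (θ : ℝ) (x : Fin n → ℂ) => h (circleMap 0 1 θ • x)) := by
      have := hh.continuous
      unfold Function.uncurry
      fun_prop
    refine (hc.continuousOn.integrableOn_compact
      ((isCompact_uIcc (a := 0) (b := 2 * Real.pi)).prod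
        (isCompact_closedBall (0 : Fin n → ℂ) R))).mono_set ?_
    exact Set.prod_mono Set.uIoc_subset_uIcc le_rfl
  have hswap := intervalIntegral_integral_swap (μ := volume.restrict B) hint
  simp only [hrot, hcirc, intervalIntegral.integral_const, sub_zero, integral_const,
    MeasureTheory.measureReal_restrict_apply_univ] at hswap
  rw [smul_comm] at hswap
  have := smul_right_injective ℂ (by positivity : (2 * Real.pi : ℝ) ≠ 0) hswap
  rw [this, Complex.real_smul]

theorem setIntegral_closedBall_eq_center {h : (Fin n → ℂ) → ℂ} (hh : Differentiable ℂ h)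
    (y : Fin n → ℂ) (R : ℝ) :
    ∫ x in Metric.closedBall y R, h x =
      (volume.real (Metric.closedBall y R) : ℂ) * h y := by
  have hpre : (fun x : Fin n → ℂ => y + x) ⁻¹' Metric.closedBall y R = Metric.closedBall 0 R := by
    ext x; simp
  have h1 := (measurePreserving_add_left volume y).setIntegral_preimage_emb
    (measurableEmbedding_addLeft y) h (Metric.closedBall y R)
  have h2 := (measurePreserving_add_left volume y).measure_preimage_emb
    (measurableEmbedding_addLeft y) (Metric.closedBall y R)
  rw [hpre] at h1 h2
  have h3 := setIntegral_closedBall_eq (h := fun x => h (y + x))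
    (hh.comp (differentiable_id.const_add y)) R
  rw [← h1, h3, Measure.real, h2, Measure.real, add_zero]

/-- The mean value property applied to the holomorphic function `h ^ 2`. -/
theorem measure_closedBall_mul_sq_norm_le {h : (Fin n → ℂ) → ℂ} (hh : Differentiable ℂ h)
    (y : Fin n → ℂ) (R : ℝ) :
    volume.real (Metric.closedBall y R) * ‖h y‖ ^ 2 ≤ ∫ x in Metric.closedBall y R, ‖h x‖ ^ 2 := by
  have h1 := setIntegral_closedBall_eq_center (hh.pow 2) y R
  have h2 := norm_integral_le_integral_norm (μ := volume.restrict (Metric.closedBall y R))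
    (h ^ 2)
  rw [h1, norm_mul, Complex.norm_real, Real.norm_of_nonneg measureReal_nonneg] at h2
  simpa using h2

/-! ### Weighted densities and the local estimate. -/

/-- The density `|u|² e^{-2Φ}`. -/
noncomputable def weightedSq (Φ : (Fin n → ℂ) → ℝ) (u : (Fin n → ℂ) → ℂ) (x : Fin n → ℂ) : ℝ :=
  ‖u x‖ ^ 2 * Real.exp (-2 * Φ x)

theorem weightedSq_nonneg (Φ : (Fin n → ℂ) → ℝ) (u : (Fin n → ℂ) → ℂ) (x : Fin n → ℂ) :
    0 ≤ weightedSq Φ u x := by unfold weightedSq; positivity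

theorem continuous_weightedSq {Φ : (Fin n → ℂ) → ℝ} (hΦ : Continuous Φ) {u : (Fin n → ℂ) → ℂ}
    (hu : Continuous u) : Continuous (weightedSq Φ u) := by
  unfold weightedSq; fun_prop

theorem eLpNorm_weightedMeasure_sq {Φ : (Fin n → ℂ) → ℝ} (hΦ : Continuous Φ)
    {u : (Fin n → ℂ) → ℂ} (hu : Continuous u) :
    eLpNorm u 2 (weightedMeasure Φ) ^ 2 = ∫⁻ x, ENNReal.ofReal (weightedSq Φ u x) := by
  have h := eLpNorm_nnreal_pow_eq_lintegral (f := u) (μ := weightedMeasure Φ) (p := 2) two_ne_zero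
  have h2 : ((2 : ℝ≥0) : ℝ) = ((2 : ℕ) : ℝ) := by norm_num
  simp only [h2, ENNReal.rpow_natCast] at h
  have h3 : ((2 : ℝ≥0) : ℝ≥0∞) = 2 := by norm_num
  rw [h3] at h
  rw [h, weightedMeasure, lintegral_withDensity_eq_lintegral_mul _ (by fun_prop)
    (by have := hu.measurable; fun_prop)]
  refine lintegral_congr fun x => ?_
  rw [Pi.mul_apply, weightedSq, mul_comm, ENNReal.ofReal_mul (by positivity),
    ENNReal.ofReal_pow (norm_nonneg _), ofReal_norm]

theorem memLp_weightedMeasure_iff {Φ : (Fin n → ℂ) → ℝ} (hΦ : Continuous Φ)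
    {u : (Fin n → ℂ) → ℂ} (hu : Continuous u) :
    MemLp u 2 (weightedMeasure Φ) ↔ ∫⁻ x, ENNReal.ofReal (weightedSq Φ u x) < ⊤ := by
  rw [← eLpNorm_weightedMeasure_sq hΦ hu, MemLp]
  simp [hu.aestronglyMeasurable]

/-- Holomorphic functions satisfy a local weighted sub-mean value estimate with a constant
independent of the centre. -/
theorem exists_weightedSq_le (Φ : QuadraticForm ℝ (Fin n → ℂ)) :
    ∃ C : ℝ, 0 ≤ C ∧ ∀ v : (Fin n → ℂ) → ℂ, Differentiable ℂ v → ∀ y,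
      weightedSq Φ v y ≤ C * ∫ x in Metric.closedBall y 1, weightedSq Φ v x := by
  obtain ⟨M, hM0, hM⟩ := exists_le_mul_sq_norm (continuous_leviPart Φ) (leviPart_smul Φ)
  set V := volume.real (Metric.closedBall (0 : Fin n → ℂ) 1)
  have hV : 0 < V := by
    refine ENNReal.toReal_pos (Metric.measure_closedBall_pos _ _ one_pos).ne'
      (isCompact_closedBall _ _).measure_lt_top.ne
  refine ⟨V⁻¹ * Real.exp (2 * M), by positivity, fun v hv y => ?_⟩
  -- The holomorphic factor replaces the weight by `exp (2 * leviPart Φ (x - y))`, which is 1 at the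
  -- centre and at most `exp (2 * M)` on the unit ball.
  set h : (Fin n → ℂ) → ℂ := fun x => v x *
    Complex.exp (-holomorphicPart Φ x - 2 * hermitianPart Φ y x + leviPart Φ y) with hh
  have hd : Differentiable ℂ h := by
    have h1 := differentiable_holomorphicPart Φ
    have h2 := differentiable_linearMap (hermitianPart Φ y)
    exact hv.mul (((h1.neg.sub (h2.const_mul 2)).add_const _).cexp)
  have hnorm (x : Fin n → ℂ) :
      ‖h x‖ ^ 2 = weightedSq Φ v x * Real.exp (2 * leviPart Φ (x - y)) := by
    rw [hh, weightedSq, norm_mul, Complex.norm_exp, mul_pow, ← Real.exp_nat_mul, mul_assoc,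
      ← Real.exp_add, leviPart_sub, ← leviPart_add_re_holomorphicPart Φ x]
    congr 2
    simp
    ring
  have h1 := measure_closedBall_mul_sq_norm_le hd y 1
  have hVy : volume.real (Metric.closedBall y 1) = V := by
    simp only [V, Measure.real, Measure.addHaar_closedBall_center]
  have h0 : leviPart Φ (y - y) = 0 := by
    rw [sub_self]; simpa using leviPart_smul Φ 0 0
  rw [hVy, hnorm y, h0, mul_zero, Real.exp_zero, mul_one] at h1
  have hcw := continuous_weightedSq (continuous_quadraticForm Φ) hv.continuous
  have h2 : ∫ x in Metric.closedBall y 1, ‖h x‖ ^ 2 ≤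
      ∫ x in Metric.closedBall y 1, Real.exp (2 * M) * weightedSq Φ v x := by
    refine setIntegral_mono_on
      ((hd.continuous.norm.pow 2).continuousOn.integrableOn_compact (isCompact_closedBall _ _))
      ((hcw.const_mul _).continuousOn.integrableOn_compact (isCompact_closedBall _ _))
      measurableSet_closedBall fun x hx => ?_
    rw [hnorm, mul_comm]
    refine mul_le_mul_of_nonneg_right (Real.exp_le_exp.2 ?_) (weightedSq_nonneg _ _ _)
    have h3 : ‖x - y‖ ≤ 1 := by simpa [dist_eq_norm] using hx
    have h4 : ‖x - y‖ ^ 2 ≤ 1 := by nlinarith [norm_nonneg (x - y)]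
    have h5 := hM (x - y)
    nlinarith
  rw [integral_const_mul] at h2
  rw [mul_assoc, le_inv_mul_iff₀ hV]
  exact h1.trans h2

theorem setIntegral_ofReal_closedBall {f : (Fin n → ℂ) → ℝ} (hf : Continuous f)
    (h0 : ∀ x, 0 ≤ f x) (y : Fin n → ℂ) (R : ℝ) :
    ENNReal.ofReal (∫ x in Metric.closedBall y R, f x) =
      ∫⁻ x in Metric.closedBall y R, ENNReal.ofReal (f x) :=
  ofReal_integral_eq_lintegral_ofReal
    (hf.continuousOn.integrableOn_compact (isCompact_closedBall _ _)) (Filter.Eventually.of_forall h0)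

theorem exists_ofReal_weightedSq_le (Φ : QuadraticForm ℝ (Fin n → ℂ)) :
    ∃ C : ℝ≥0, ∀ v : (Fin n → ℂ) → ℂ, Differentiable ℂ v → ∀ y,
      ENNReal.ofReal (weightedSq Φ v y) ≤
        C * ∫⁻ x in Metric.closedBall y 1, ENNReal.ofReal (weightedSq Φ v x) := by
  obtain ⟨C, hC, h⟩ := exists_weightedSq_le Φ
  refine ⟨C.toNNReal, fun v hv y => ?_⟩
  rw [← setIntegral_ofReal_closedBall
    (continuous_weightedSq (continuous_quadraticForm Φ) hv.continuous) (weightedSq_nonneg _ _)]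
  refine (ENNReal.ofReal_le_ofReal (h v hv y)).trans_eq ?_
  rw [ENNReal.ofReal_mul hC]; rfl

/-! ### Coherent states. -/

/-- The (unnormalized) coherent state of `H_Φ` centred at `w`. -/
noncomputable def coherentState (Φ : QuadraticForm ℝ (Fin n → ℂ)) (w x : Fin n → ℂ) : ℂ :=
  Complex.exp (holomorphicPart Φ x + 2 * hermitianPart Φ w x - leviPart Φ w)

theorem differentiable_coherentState (Φ : QuadraticForm ℝ (Fin n → ℂ)) (w : Fin n → ℂ) :
    Differentiable ℂ (coherentState Φ w) := by
  have h1 := differentiable_holomorphicPart Φ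
  have h2 := differentiable_linearMap (hermitianPart Φ w)
  exact ((h1.add (h2.const_mul 2)).sub_const _).cexp

theorem weightedSq_coherentState (Φ : QuadraticForm ℝ (Fin n → ℂ)) (w x : Fin n → ℂ) :
    weightedSq Φ (coherentState Φ w) x = Real.exp (-2 * leviPart Φ (x - w)) := by
  rw [weightedSq, coherentState, Complex.norm_exp, ← Real.exp_nat_mul, ← Real.exp_add,
    leviPart_sub, ← leviPart_add_re_holomorphicPart Φ x]
  congr 1
  simp
  ring

theorem lintegral_weightedSq_coherentState (Φ : QuadraticForm ℝ (Fin n → ℂ)) (w : Fin n → ℂ) :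
    ∫⁻ x, ENNReal.ofReal (weightedSq Φ (coherentState Φ w) x) =
      ∫⁻ x, ENNReal.ofReal (Real.exp (-2 * leviPart Φ x)) := by
  simp only [weightedSq_coherentState]
  exact lintegral_sub_right_eq_self (μ := volume)
    (fun x => ENNReal.ofReal (Real.exp (-2 * leviPart Φ x))) w

theorem StrictlyPlurisubharmonic.lintegral_exp_neg_leviPart_lt_top
    {Φ : QuadraticForm ℝ (Fin n → ℂ)} (hΦ : StrictlyPlurisubharmonic Φ) :
    ∫⁻ x, ENNReal.ofReal (Real.exp (-2 * leviPart Φ x)) < ⊤ := by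
  obtain ⟨δ, hδ, h⟩ := exists_mul_sq_norm_le (continuous_leviPart Φ) (leviPart_smul Φ)
    fun x hx => hΦ.leviPart_pos hx
  refine lt_of_le_of_lt (lintegral_mono fun x => ENNReal.ofReal_le_ofReal ?_)
    (integrable_exp_neg_mul_sq_norm (n := n) (by positivity : 0 < 2 * δ)).lintegral_lt_top
  rw [Real.exp_le_exp]
  linarith [h x]

theorem StrictlyPlurisubharmonic.coherentState_mem {Φ : QuadraticForm ℝ (Fin n → ℂ)}
    (hΦ : StrictlyPlurisubharmonic Φ) (w : Fin n → ℂ) : coherentState Φ w ∈ bargmannSpace Φ := by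
  have hd := differentiable_coherentState Φ w
  refine ⟨hd, (memLp_weightedMeasure_iff (continuous_quadraticForm Φ) hd.continuous).2 ?_⟩
  rw [lintegral_weightedSq_coherentState]
  exact hΦ.lintegral_exp_neg_leviPart_lt_top

/-! ### Necessity: the bound on the exponent. -/

/-- A set of full Lebesgue measure is dense, so for continuous `g` the almost everywhere bound holds
everywhere. -/
theorem memLp_top_exp_iff {g : (Fin n → ℂ) → ℝ} (hg : Continuous g) :
    MemLp (fun x => Real.exp (g x)) ∞ (volume : Measure (Fin n → ℂ)) ↔ ∃ C, ∀ x, g x ≤ C := by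
  constructor
  · intro h
    have h1 := ae_le_eLpNormEssSup (f := fun x => Real.exp (g x)) (μ := volume)
    rw [← eLpNorm_exponent_top] at h1
    have h2 : ∀ᵐ x, Real.exp (g x) ≤ (eLpNorm (fun x => Real.exp (g x)) ∞ volume).toReal := by
      filter_upwards [h1] with x hx
      rw [Real.enorm_eq_ofReal (Real.exp_pos _).le] at hx
      exact (ENNReal.ofReal_le_iff_le_toReal h.2.ne).1 hx
    have h3 := Measure.dense_of_ae h2
    have h4 : IsClosed
        {x | Real.exp (g x) ≤ (eLpNorm (fun x => Real.exp (g x)) ∞ volume).toReal} :=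
      isClosed_le (by fun_prop) continuous_const
    refine ⟨(eLpNorm (fun x => Real.exp (g x)) ∞ volume).toReal, fun x => ?_⟩
    have h5 : x ∈ closure
        {x | Real.exp (g x) ≤ (eLpNorm (fun x => Real.exp (g x)) ∞ volume).toReal} := h3 x
    rw [h4.closure_eq] at h5
    have h6 := Real.add_one_le_exp (g x)
    have h7 : Real.exp (g x) ≤ _ := h5
    linarith
  · rintro ⟨C, hC⟩
    refine memLp_top_of_bound (by fun_prop) (Real.exp C) (Filter.Eventually.of_forall fun x => ?_)
    rw [Real.norm_of_nonneg (Real.exp_pos _).le]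
    exact Real.exp_le_exp.2 (hC x)

theorem PullbackIsBounded.exists_le {Φ₁ : QuadraticForm ℝ (Fin n₁ → ℂ)}
    {Φ₂ : QuadraticForm ℝ (Fin n₂ → ℂ)} (hΦ₁ : StrictlyPlurisubharmonic Φ₁)
    {φ : (Fin n₂ → ℂ) → (Fin n₁ → ℂ)} (hφ : Differentiable ℂ φ)
    (h : PullbackIsBounded Φ₁ Φ₂ φ) : ∃ C, ∀ y, Φ₁ (φ y) - Φ₂ y ≤ C := by
  obtain ⟨-, C, hC⟩ := h
  obtain ⟨K, hK⟩ := exists_ofReal_weightedSq_le Φ₂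
  set I := ∫⁻ x, ENNReal.ofReal (Real.exp (-2 * leviPart Φ₁ x))
  have hI : I < ⊤ := hΦ₁.lintegral_exp_neg_leviPart_lt_top
  have hT : (K : ℝ≥0∞) * (C ^ 2 * I) ≠ ⊤ :=
    ENNReal.mul_ne_top ENNReal.coe_ne_top
      (ENNReal.mul_ne_top (ENNReal.pow_ne_top ENNReal.coe_ne_top) hI.ne)
  refine ⟨((K : ℝ≥0∞) * (C ^ 2 * I)).toReal / 2, fun y => ?_⟩
  set u := coherentState Φ₁ (φ y)
  have hu : Differentiable ℂ u := differentiable_coherentState Φ₁ (φ y)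
  have hv : Differentiable ℂ (pullback φ u) := hu.comp hφ
  have h1 : ENNReal.ofReal (weightedSq Φ₂ (pullback φ u) y) ≤ K * (C ^ 2 * I) := by
    refine (hK _ hv y).trans (mul_le_mul_right ?_ _)
    refine (setLIntegral_le_lintegral _ _).trans ?_
    rw [← eLpNorm_weightedMeasure_sq (continuous_quadraticForm Φ₂) hv.continuous]
    have h2 := hC u (hΦ₁.coherentState_mem (φ y))
    calc _ ≤ ((C : ℝ≥0∞) * eLpNorm u 2 (weightedMeasure Φ₁)) ^ 2 := by gcongr
      _ = _ := by
        rw [mul_pow, eLpNorm_weightedMeasure_sq (continuous_quadraticForm Φ₁) hu.continuous,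
          lintegral_weightedSq_coherentState]
  have h2 : weightedSq Φ₂ (pullback φ u) y = Real.exp (2 * (Φ₁ (φ y) - Φ₂ y)) := by
    have h3 := weightedSq_coherentState Φ₁ (φ y) (φ y)
    have h4 : leviPart Φ₁ 0 = 0 := by simpa using leviPart_smul Φ₁ 0 0
    rw [sub_self, h4, mul_zero, Real.exp_zero, weightedSq] at h3
    have h5 : ‖u (φ y)‖ ^ 2 = Real.exp (2 * Φ₁ (φ y)) := by
      rw [eq_comm, ← mul_one (Real.exp _), ← h3, mul_left_comm, ← Real.exp_add]
      simp [u]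
    rw [weightedSq, pullback, Function.comp_apply, h5, ← Real.exp_add]
    congr 1; ring
  rw [h2, ENNReal.ofReal_le_iff_le_toReal hT] at h1
  have h3 := Real.add_one_le_exp (2 * (Φ₁ (φ y) - Φ₂ y))
  linarith

/-! ### Necessity: the map is affine. -/

/-- Liouville's theorem for maps of linear growth. -/
theorem eq_add_fderiv_of_linear_growth {f : (Fin n₂ → ℂ) → (Fin n₁ → ℂ)}
    (hf : Differentiable ℂ f) {D : ℝ} (hD : ∀ x, ‖f x‖ ≤ D * (‖x‖ + 1)) (x : Fin n₂ → ℂ) :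
    f x = f 0 + fderiv ℂ f 0 x := by
  have hD0 : 0 ≤ D := by
    have := (norm_nonneg _).trans (hD 0)
    simpa using this
  set g : ℂ → (Fin n₁ → ℂ) := fun z => f (z • x) with hg
  have hgd : Differentiable ℂ g := hf.comp (differentiable_id.smul_const x)
  have hbound (w : ℂ) : ‖deriv g w‖ ≤ D * (‖x‖ + 1) := by
    -- On the circle of this radius about `w` the growth bound is `D * (‖x‖ + 1)` times the radius,
    -- so Cauchy's estimate is uniform in `w`.
    have hR : 0 < ‖w‖ * ‖x‖ + 1 := by positivity
    have h1 := Complex.norm_deriv_le_of_forall_mem_sphere_norm_le (c := w) (f := g)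
      (C := D * ((‖w‖ * ‖x‖ + 1) * (‖x‖ + 1))) hR hgd.diffContOnCl fun z hz => by
        refine (hD _).trans (mul_le_mul_of_nonneg_left ?_ hD0)
        have h2 : ‖z‖ ≤ (‖w‖ * ‖x‖ + 1) + ‖w‖ := by
          have := norm_add_le (z - w) w
          rw [sub_add_cancel, mem_sphere_iff_norm.1 hz] at this
          exact this
        rw [norm_smul]
        nlinarith [mul_le_mul_of_nonneg_right h2 (norm_nonneg x)]
    refine h1.trans_eq ?_
    field_simp
  have hconst (w : ℂ) : deriv g w = deriv g 0 := by
    refine hgd.deriv.apply_eq_apply_of_bounded ?_ w 0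
    refine isBounded_iff_forall_norm_le.2 ⟨D * (‖x‖ + 1), ?_⟩
    rintro _ ⟨w, rfl⟩
    exact hbound w
  have h0 : deriv g 0 = fderiv ℂ f 0 x := by
    have h1 : HasFDerivAt f (fderiv ℂ f 0) ((0 : ℂ) • x) := by
      rw [zero_smul]; exact (hf 0).hasFDerivAt
    have h2 : HasDerivAt (fun z : ℂ => z • x) x 0 := by
      simpa using (hasDerivAt_id (0 : ℂ)).smul_const x
    exact (h1.comp_hasDerivAt (0 : ℂ) h2).deriv
  have hd (w : ℂ) : HasDerivAt (fun z => g z - z • fderiv ℂ f 0 x) 0 w := by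
    have h1 := (hgd w).hasDerivAt.sub ((hasDerivAt_id w).smul_const (fderiv ℂ f 0 x))
    rw [hconst, h0, one_smul, sub_self] at h1
    exact h1
  have h3 := is_const_of_deriv_eq_zero (fun w => (hd w).differentiableAt)
    (fun w => (hd w).deriv) 1 0
  simp only [hg, one_smul, zero_smul, sub_zero] at h3
  rw [← h3, sub_add_cancel]

theorem exists_linear_growth {Φ₁ : QuadraticForm ℝ (Fin n₁ → ℂ)}
    {Φ₂ : QuadraticForm ℝ (Fin n₂ → ℂ)} (hΦ₁ : StrictlyPlurisubharmonic Φ₁)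
    {φ : (Fin n₂ → ℂ) → (Fin n₁ → ℂ)} (hφ : Differentiable ℂ φ) {C : ℝ}
    (hC : ∀ y, Φ₁ (φ y) - Φ₂ y ≤ C) : ∃ D, ∀ x, ‖φ x‖ ≤ D * (‖x‖ + 1) := by
  obtain ⟨δ, hδ, hL⟩ := exists_mul_sq_norm_le (continuous_leviPart Φ₁) (leviPart_smul Φ₁)
    fun x hx => hΦ₁.leviPart_pos hx
  obtain ⟨M, hM0, hM⟩ := exists_le_mul_sq_norm (continuous_quadraticForm Φ₂)
    (fun t x => by rw [QuadraticMap.map_smul, smul_eq_mul, _root_.sq])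
  set V : ℝ → ℝ := fun R => volume.real (Metric.closedBall (0 : Fin n₂ → ℂ) R)
  set q := (holomorphicPart Φ₁ (φ 0)).re
  have hqd : Differentiable ℂ (fun x => holomorphicPart Φ₁ (φ x)) :=
    (differentiable_holomorphicPart Φ₁).comp hφ
  -- Integrating `L₁ ∘ φ ≤ Φ₂ + C - Re (q₁ ∘ φ)`: the mean of the last term is its value `q` at 0.
  have hmean (R : ℝ) : δ * ∫ x in Metric.closedBall 0 R, ‖φ x‖ ^ 2 ≤
      V R * (M * R ^ 2 + C - q) := by
    have hre : ∫ x in Metric.closedBall 0 R, (holomorphicPart Φ₁ (φ x)).re = V R * q := by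
      have h1 := integral_re (𝕜 := ℂ) (hqd.continuous.continuousOn.integrableOn_compact
        (μ := volume) (isCompact_closedBall (0 : Fin n₂ → ℂ) R))
      rw [setIntegral_closedBall_eq hqd] at h1
      simpa [q, V] using h1
    have hc1 : IntegrableOn (fun x => (holomorphicPart Φ₁ (φ x)).re)
        (Metric.closedBall (0 : Fin n₂ → ℂ) R) :=
      (Complex.continuous_re.comp hqd.continuous).continuousOn.integrableOn_compact
        (isCompact_closedBall _ _)
    have hc2 : IntegrableOn (fun _ : Fin n₂ → ℂ => M * R ^ 2 + C) (Metric.closedBall 0 R) :=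
      continuousOn_const.integrableOn_compact (isCompact_closedBall _ _)
    have hc3 : IntegrableOn (fun x => δ * ‖φ x‖ ^ 2) (Metric.closedBall (0 : Fin n₂ → ℂ) R) :=
      ((hφ.continuous.norm.pow 2).const_mul δ).continuousOn.integrableOn_compact
        (isCompact_closedBall _ _)
    have h2 : ∫ x in Metric.closedBall 0 R, δ * ‖φ x‖ ^ 2 ≤
        ∫ x in Metric.closedBall 0 R, ((M * R ^ 2 + C) - (holomorphicPart Φ₁ (φ x)).re) := by
      refine setIntegral_mono_on hc3 (hc2.sub hc1) measurableSet_closedBall fun x hx => ?_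
      have h3 := hL (φ x)
      have h4 := leviPart_add_re_holomorphicPart Φ₁ (φ x)
      have h5 := hC x
      have h6 := hM x
      have h7 : ‖x‖ ^ 2 ≤ R ^ 2 := by
        have : ‖x‖ ≤ R := by simpa using hx
        gcongr
      nlinarith
    rw [integral_const_mul, integral_sub hc2 hc1, hre, setIntegral_const, smul_eq_mul] at h2
    refine h2.trans_eq ?_
    simp only [V]; ring
  set d := Module.finrank ℝ (Fin n₂ → ℂ)
  have hV (R : ℝ) (hR : 0 ≤ R) : V (2 * R) = 2 ^ d * V R := by
    simp only [V, Measure.real]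
    rw [Measure.addHaar_closedBall_mul _ _ zero_le_two hR, ENNReal.toReal_mul,
      ENNReal.toReal_ofReal (by positivity)]
  -- The factor `2 ^ d` is the volume ratio on passing from the ball of radius `R = ‖w‖ + 1` at `w`
  -- to that of radius `2 * R` at 0; `1 ≤ R` absorbs `C - q` into `R ^ 2`.
  set D := 2 ^ d * (4 * M + |C - q|) / δ with hDdef
  have hD0 : 0 ≤ D := by positivity
  refine ⟨√D, fun w => ?_⟩
  set R := ‖w‖ + 1
  have hR : 1 ≤ R := by simp [R]
  refine (pi_norm_le_iff_of_nonneg (by positivity)).2 fun j => ?_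
  refine le_of_sq_le_sq ?_ (by positivity)
  rw [mul_pow, Real.sq_sqrt hD0]
  have hφj : Differentiable ℂ (fun x => φ x j) := differentiable_pi.1 hφ j
  have h1 := measure_closedBall_mul_sq_norm_le hφj w R
  have hVw : volume.real (Metric.closedBall w R) = V R := by
    simp only [V, Measure.real, Measure.addHaar_closedBall_center]
  have hVpos : 0 < V R :=
    ENNReal.toReal_pos (Metric.measure_closedBall_pos _ _ (by linarith)).ne'
      (isCompact_closedBall _ _).measure_lt_top.ne
  have hi : IntegrableOn (fun x => ‖φ x‖ ^ 2) (Metric.closedBall (0 : Fin n₂ → ℂ) (2 * R)) :=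
    (hφ.continuous.norm.pow 2).continuousOn.integrableOn_compact (isCompact_closedBall _ _)
  have hsub : Metric.closedBall w R ⊆ Metric.closedBall 0 (2 * R) := by
    refine Metric.closedBall_subset_closedBall' ?_
    rw [dist_zero_right]; simp only [R]; linarith
  have h2 : ∫ x in Metric.closedBall w R, ‖φ x j‖ ^ 2 ≤
      ∫ x in Metric.closedBall 0 (2 * R), ‖φ x‖ ^ 2 := by
    refine (setIntegral_mono_on ((hφj.continuous.norm.pow 2).continuousOn.integrableOn_compact
      (isCompact_closedBall _ _)) (hi.mono_set hsub) measurableSet_closedBall fun x _ => ?_).trans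
      (setIntegral_mono_set hi (Filter.Eventually.of_forall fun x => by positivity)
        hsub.eventuallyLE)
    exact pow_le_pow_left₀ (norm_nonneg _) (norm_le_pi_norm (φ x) j) 2
  have h3 := hmean (2 * R)
  rw [hV R (by linarith)] at h3
  rw [hVw] at h1
  have h4 : M * (2 * R) ^ 2 + C - q ≤ (4 * M + |C - q|) * R ^ 2 := by
    have := le_abs_self (C - q)
    have h5 : 1 ≤ R ^ 2 := by nlinarith
    nlinarith [abs_nonneg (C - q)]
  have h5 : V R * (δ * ‖φ w j‖ ^ 2) ≤ V R * (2 ^ d * ((4 * M + |C - q|) * R ^ 2)) := by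
    calc V R * (δ * ‖φ w j‖ ^ 2) = δ * (V R * ‖φ w j‖ ^ 2) := by ring
      _ ≤ δ * ∫ x in Metric.closedBall 0 (2 * R), ‖φ x‖ ^ 2 :=
        mul_le_mul_of_nonneg_left (h1.trans h2) hδ.le
      _ ≤ 2 ^ d * V R * (M * (2 * R) ^ 2 + C - q) := h3
      _ ≤ 2 ^ d * V R * ((4 * M + |C - q|) * R ^ 2) := by gcongr
      _ = _ := by ring
  have h6 := le_of_mul_le_mul_left h5 hVpos
  rw [hDdef, div_mul_eq_mul_div, le_div_iff₀ hδ]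
  linarith

/-! ### Necessity: the kernel condition. -/

/-- Infinitely many disjoint balls of equal volume, translated along `v`, carry `f` above `f 0 / 2`.
-/
theorem lintegral_eq_top_of_translation_invariant {f : (Fin n → ℂ) → ℝ} (hf : Continuous f)
    (h0 : 0 < f 0) {v : Fin n → ℂ} (hv : v ≠ 0) (hinv : ∀ x (t : ℝ), f (x + t • v) = f x) :
    ∫⁻ x, ENNReal.ofReal (f x) = ⊤ := by
  obtain ⟨r, hr, hball⟩ : ∃ r > 0, ∀ x ∈ Metric.ball 0 r, f 0 / 2 < f x :=
    Metric.eventually_nhds_iff_ball.1 (hf.continuousAt.eventually_const_lt (by linarith))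
  have hv' : 0 < ‖v‖ := norm_pos_iff.2 hv
  set s : ℕ → Set (Fin n → ℂ) := fun k => Metric.ball ((k * (2 * r / ‖v‖) : ℝ) • v) r
  have hdisj : Pairwise (Function.onFun Disjoint s) := by
    intro k l hkl
    refine Metric.ball_disjoint_ball ?_
    rw [dist_eq_norm, ← sub_smul, norm_smul, ← sub_mul, norm_mul,
      Real.norm_of_nonneg (by positivity : 0 ≤ 2 * r / ‖v‖), mul_assoc, div_mul_cancel₀ _ hv'.ne']
    have h1 : (1 : ℝ) ≤ ‖(k : ℝ) - l‖ := by
      have h2 : (1 : ℤ) ≤ |(k : ℤ) - l| := Int.one_le_abs (sub_ne_zero.2 (by exact_mod_cast hkl))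
      rw [Real.norm_eq_abs]
      exact_mod_cast h2
    nlinarith
  have hmeas : volume (⋃ k, s k) = ⊤ := by
    rw [measure_iUnion hdisj fun k => measurableSet_ball]
    simp only [s, Measure.addHaar_ball_center]
    exact ENNReal.tsum_const_eq_top_of_ne_zero (Metric.measure_ball_pos _ _ hr).ne'
  rw [eq_top_iff]
  calc ⊤ = ∫⁻ _ in ⋃ k, s k, ENNReal.ofReal (f 0 / 2) := by
        rw [setLIntegral_const, hmeas, ENNReal.mul_top (by simpa using h0)]
    _ ≤ ∫⁻ x in ⋃ k, s k, ENNReal.ofReal (f x) := by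
        refine setLIntegral_mono (by fun_prop) fun x hx => ENNReal.ofReal_le_ofReal ?_
        obtain ⟨k, hk⟩ := Set.mem_iUnion.1 hx
        have h1 := hball (x + (-(k * (2 * r / ‖v‖)) : ℝ) • v) (by
          simpa [s, dist_eq_norm, neg_smul, sub_eq_add_neg] using hk)
        rw [hinv] at h1
        exact h1.le
    _ ≤ _ := setLIntegral_le_lintegral _ _

theorem eq_zero_of_forall_le_quadratic {a b c : ℝ} (hc : c ≤ 0)
    (h : ∀ t : ℝ, 0 ≤ a + t * b + t ^ 2 * c) : b = 0 ∧ c = 0 := by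
  have ha : 0 ≤ a := by simpa using h 0
  have hc' : c = 0 := by
    by_contra hne
    have hlt : c < 0 := lt_of_le_of_ne hc hne
    -- Adding the values at opposite points cancels `b`; the point is far enough out for the `c`
    -- term to beat `a`.
    have h1 := h ((a + 1) / -c + 1)
    have h2 := h (-((a + 1) / -c + 1))
    have h3 : (a + 1) / -c * c = -(a + 1) := by field_simp
    have h4 : 0 ≤ (a + 1) / -c := div_nonneg (by linarith) (by linarith)
    nlinarith
  refine ⟨?_, hc'⟩
  subst hc'
  by_contra hb
  have h1 := h (-(a + 1) / b)
  rw [div_mul_cancel₀ _ hb] at h1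
  linarith

theorem PullbackIsBounded.mulVec_ne_zero {Φ₁ : QuadraticForm ℝ (Fin n₁ → ℂ)}
    {Φ₂ : QuadraticForm ℝ (Fin n₂ → ℂ)} (hΦ₁ : StrictlyPlurisubharmonic Φ₁)
    {φ : (Fin n₂ → ℂ) → (Fin n₁ → ℂ)} (hφ : Differentiable ℂ φ)
    (h : PullbackIsBounded Φ₁ Φ₂ φ) {A : Matrix (Fin n₁) (Fin n₂) ℂ} {b : Fin n₁ → ℂ}
    (hA : ∀ x, φ x = A *ᵥ x + b) {v : Fin n₂ → ℂ} (hv : v ≠ 0) (hv0 : Φ₂ v ≤ 0) :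
    A *ᵥ v ≠ 0 := by
  intro hAv
  obtain ⟨C, hC⟩ := h.exists_le hΦ₁ hφ
  have hφv (x : Fin n₂ → ℂ) (t : ℝ) : φ (x + t • v) = φ x := by
    rw [hA, hA, Matrix.mulVec_add, Matrix.mulVec_smul, hAv, smul_zero, add_zero]
  have hexp (x : Fin n₂ → ℂ) (t : ℝ) : Φ₂ (x + t • v) = Φ₂ x + t * polar Φ₂ x v + t ^ 2 * Φ₂ v := by
    rw [QuadraticMap.map_add Φ₂, polar_smul_right, QuadraticMap.map_smul, smul_eq_mul, smul_eq_mul]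
    ring
  -- As `φ` is constant along `v`, the bound `C` keeps `Φ₂` bounded below on the line; with `Φ₂ v ≤
  -- 0` a quadratic polynomial can do this only if constant.
  have hΦv (x : Fin n₂ → ℂ) (t : ℝ) : Φ₂ (x + t • v) = Φ₂ x := by
    have h1 := eq_zero_of_forall_le_quadratic (a := Φ₂ x - Φ₁ (φ x) + C) (b := polar Φ₂ x v) hv0
      fun t => by
        have := hC (x + t • v)
        rw [hφv, hexp] at this
        linarith
    rw [hexp, h1.1, h1.2]; ring
  have hmem := hΦ₁.coherentState_mem 0
  have hd := differentiable_coherentState Φ₁ 0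
  have hcont : Continuous (pullback φ (coherentState Φ₁ 0)) := hd.continuous.comp hφ.continuous
  have h1 := (memLp_weightedMeasure_iff (continuous_quadraticForm Φ₂) hcont).1 (h.1 _ hmem).2
  refine h1.ne (lintegral_eq_top_of_translation_invariant
    (continuous_weightedSq (continuous_quadraticForm Φ₂) hcont) ?_ hv fun x t => ?_)
  · have : pullback φ (coherentState Φ₁ 0) 0 ≠ 0 := Complex.exp_ne_zero _
    have := norm_pos_iff.2 this
    unfold weightedSq; positivity
  · rw [weightedSq, weightedSq, hΦv, pullback, Function.comp_apply, Function.comp_apply, hφv]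

/-! ### Sufficiency. -/

theorem quadraticForm_parallelogram (Φ : QuadraticForm ℝ (Fin n → ℂ)) (m d : Fin n → ℂ) :
    Φ (m + d) + Φ (m - d) = 2 * Φ m + 2 * Φ d := by
  rw [sub_eq_add_neg, QuadraticMap.map_add Φ m d, QuadraticMap.map_add Φ m (-d), polar_neg_right,
    QuadraticMap.map_neg]
  ring

/-- If `Φ₂ - Φ₁ ∘ φ` is bounded below for the affine map `φ = A · + b`, and `Φ₂` is positive on the
kernel of `A`, then `Φ₂ - Φ₁ ∘ A` is coercive modulo `A`. -/
theorem exists_mul_sq_norm_le_sub_add {Φ₁ : QuadraticForm ℝ (Fin n₁ → ℂ)}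
    {Φ₂ : QuadraticForm ℝ (Fin n₂ → ℂ)} {A : Matrix (Fin n₁) (Fin n₂) ℂ} {b : Fin n₁ → ℂ}
    (hA : ∀ x : Fin n₂ → ℂ, x ≠ 0 → Φ₂ x ≤ 0 → A *ᵥ x ≠ 0) {C : ℝ}
    (hC : ∀ x, Φ₁ (A *ᵥ x + b) - Φ₂ x ≤ C) :
    ∃ δ, 0 < δ ∧ ∀ x, δ * ‖x‖ ^ 2 ≤ Φ₂ x - Φ₁ (A *ᵥ x) + ‖A *ᵥ x‖ ^ 2 := by
  have hcA : Continuous fun x : Fin n₂ → ℂ => A *ᵥ x := by fun_prop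
  refine exists_mul_sq_norm_le
    (((continuous_quadraticForm Φ₂).sub ((continuous_quadraticForm Φ₁).comp hcA)).add
      (hcA.norm.pow 2)) (fun t x => ?_) fun x hx => ?_
  · simp only [Matrix.mulVec_smul, QuadraticMap.map_smul, smul_eq_mul, norm_smul, mul_pow,
      Real.norm_eq_abs, sq_abs]
    ring
  -- A polynomial in `t` bounded below along `t • x` cannot have a negative leading coefficient.
  · have hG : 0 ≤ Φ₂ x - Φ₁ (A *ᵥ x) := by
      by_contra! hlt
      have h1 := eq_zero_of_forall_le_quadratic (a := C - Φ₁ b) (b := -polar Φ₁ (A *ᵥ x) b)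
        (c := Φ₂ x - Φ₁ (A *ᵥ x)) hlt.le fun t => by
          have h2 := hC (t • x)
          rw [Matrix.mulVec_smul, QuadraticMap.map_add Φ₁, polar_smul_left, QuadraticMap.map_smul,
            QuadraticMap.map_smul, smul_eq_mul, smul_eq_mul, smul_eq_mul] at h2
          linarith
      exact hlt.ne h1.2
    by_cases hAx : A *ᵥ x = 0
    · have h1 : 0 < Φ₂ x := by
        by_contra! hle
        exact hA x hx hle hAx
      simpa [hAx] using h1
    · have := norm_pos_iff.2 hAx
      positivity

/-- On the convex preimage of a unit ball, `A` varies boundedly, so coercivity modulo `A` makes `g`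
grow quadratically away from a near-minimiser. The integrand lies under a translated Gaussian whose
integral is independent of `y`. -/
theorem exists_setLIntegral_exp_le {Φ₁ : QuadraticForm ℝ (Fin n₁ → ℂ)}
    {Φ₂ : QuadraticForm ℝ (Fin n₂ → ℂ)} {A : Matrix (Fin n₁) (Fin n₂) ℂ} {b : Fin n₁ → ℂ}
    (hA : ∀ x : Fin n₂ → ℂ, x ≠ 0 → Φ₂ x ≤ 0 → A *ᵥ x ≠ 0) {C : ℝ}
    (hC : ∀ x, Φ₁ (A *ᵥ x + b) - Φ₂ x ≤ C) :
    ∃ K : ℝ≥0, ∀ y, ∫⁻ x in (fun x => A *ᵥ x + b) ⁻¹' Metric.closedBall y 1,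
      ENNReal.ofReal (Real.exp (2 * (Φ₁ (A *ᵥ x + b) - Φ₂ x))) ≤ K := by
  obtain ⟨δ, hδ, hP⟩ := exists_mul_sq_norm_le_sub_add hA hC
  have hI := ((integrable_exp_neg_mul_sq_norm (n := n₂) hδ).const_mul
    (Real.exp (2 * C + 6))).lintegral_lt_top
  refine ⟨(∫⁻ x : Fin n₂ → ℂ,
    ENNReal.ofReal (Real.exp (2 * C + 6) * Real.exp (-δ * ‖x‖ ^ 2))).toNNReal, fun y => ?_⟩
  rw [ENNReal.coe_toNNReal hI.ne]
  set S := (fun x => A *ᵥ x + b) ⁻¹' Metric.closedBall y 1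
  set g : (Fin n₂ → ℂ) → ℝ := fun x => Φ₂ x - Φ₁ (A *ᵥ x + b)
  have hg (x) : -C ≤ g x := by simp only [g]; linarith [hC x]
  have hcS : Convex ℝ S := by
    have h1 := (convex_closedBall y (1 : ℝ)).affine_preimage
      ((((Matrix.mulVecLin A).restrictScalars ℝ).toAffineMap + AffineMap.const ℝ _ b))
    exact h1
  have hgsum (m d : Fin n₂ → ℂ) :
      g (m + d) + g (m - d) = 2 * g m + 2 * (Φ₂ d - Φ₁ (A *ᵥ d)) := by
    have h1 := quadraticForm_parallelogram Φ₂ m d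
    have h2 := quadraticForm_parallelogram Φ₁ (A *ᵥ m + b) (A *ᵥ d)
    simp only [g, Matrix.mulVec_add, Matrix.mulVec_sub]
    rw [add_right_comm (A *ᵥ m), sub_add_eq_add_sub (A *ᵥ m)]
    linarith
  rcases S.eq_empty_or_nonempty with hS | hS
  · simp [hS]
  -- A point within 1 of the infimum suffices, so no minimum need be attained.
  obtain ⟨_, ⟨x₀, hx₀, rfl⟩, hlt⟩ :=
    exists_lt_of_csInf_lt (hS.image g) (lt_add_one (sInf (g '' S)))
  have hbdd : BddBelow (g '' S) := ⟨-C, by rintro _ ⟨x, -, rfl⟩; exact hg x⟩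
  have hinf : -C ≤ sInf (g '' S) :=
    le_csInf (hS.image g) (by rintro _ ⟨x, -, rfl⟩; exact hg x)
  -- The parallelogram identity at the midpoint `m ∈ S` gives `g x ≥ 2 * inf - g x₀ + δ / 2 * ‖x -
  -- x₀‖ ^ 2 - 2`. The 2 comes from `‖A *ᵥ d‖ ≤ 1`, and `g x₀ < inf + 1` costs one more.
  have hlower (x) (hx : x ∈ S) : -C - 3 + δ / 2 * ‖x - x₀‖ ^ 2 ≤ g x := by
    set d := (1 / 2 : ℝ) • (x - x₀)
    set m := (1 / 2 : ℝ) • x + (1 / 2 : ℝ) • x₀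
    have hm : m ∈ S := hcS hx hx₀ (by norm_num) (by norm_num) (by norm_num)
    have h1 : m + d = x := by simp only [m, d]; module
    have h2 : m - d = x₀ := by simp only [m, d]; module
    have h3 := hgsum m d
    rw [h1, h2] at h3
    have h4 : sInf (g '' S) ≤ g m := csInf_le hbdd ⟨m, hm, rfl⟩
    have h5 := hP d
    have h6 : ‖d‖ ^ 2 = 1 / 4 * ‖x - x₀‖ ^ 2 := by
      simp only [d, norm_smul, mul_pow]; norm_num
    have h7 : ‖A *ᵥ d‖ ≤ 1 := by
      have h8 : A *ᵥ d = (1 / 2 : ℝ) • ((A *ᵥ x + b) - (A *ᵥ x₀ + b)) := by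
        simp only [d, Matrix.mulVec_smul, Matrix.mulVec_sub]; congr 1; abel
      have h9 : dist (A *ᵥ x + b) (A *ᵥ x₀ + b) ≤ 1 + 1 :=
        (dist_triangle_right _ _ y).trans (add_le_add hx hx₀)
      rw [h8, norm_smul, ← dist_eq_norm, Real.norm_of_nonneg (by norm_num)]
      linarith
    have h10 : ‖A *ᵥ d‖ ^ 2 ≤ 1 := by nlinarith [norm_nonneg (A *ᵥ d)]
    rw [h6] at h5
    linarith
  calc ∫⁻ x in S, ENNReal.ofReal (Real.exp (2 * (Φ₁ (A *ᵥ x + b) - Φ₂ x)))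
      ≤ ∫⁻ x in S, ENNReal.ofReal
          (Real.exp (2 * C + 6) * Real.exp (-δ * ‖x - x₀‖ ^ 2)) := by
        refine setLIntegral_mono (by fun_prop) fun x hx => ENNReal.ofReal_le_ofReal ?_
        rw [← Real.exp_add, Real.exp_le_exp]
        have := hlower x hx
        simp only [g] at this
        linarith
    _ ≤ ∫⁻ x, ENNReal.ofReal (Real.exp (2 * C + 6) * Real.exp (-δ * ‖x - x₀‖ ^ 2)) :=
        setLIntegral_le_lintegral _ _
    _ = _ := lintegral_sub_right_eq_self (μ := volume)
        (fun x => ENNReal.ofReal (Real.exp (2 * C + 6) * Real.exp (-δ * ‖x‖ ^ 2))) x₀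

theorem pullbackIsBounded_of_affine {Φ₁ : QuadraticForm ℝ (Fin n₁ → ℂ)}
    {Φ₂ : QuadraticForm ℝ (Fin n₂ → ℂ)} {A : Matrix (Fin n₁) (Fin n₂) ℂ} {b : Fin n₁ → ℂ}
    (hA : ∀ x : Fin n₂ → ℂ, x ≠ 0 → Φ₂ x ≤ 0 → A *ᵥ x ≠ 0) {C : ℝ}
    (hC : ∀ x, Φ₁ (A *ᵥ x + b) - Φ₂ x ≤ C) :
    PullbackIsBounded Φ₁ Φ₂ fun x => A *ᵥ x + b := by
  set φ : (Fin n₂ → ℂ) → (Fin n₁ → ℂ) := fun x => A *ᵥ x + b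
  have hφ : Differentiable ℂ φ :=
    ((LinearMap.toContinuousLinearMap (Matrix.mulVecLin A)).differentiable).add_const b
  have hφc := hφ.continuous
  have hΦ₁c := continuous_quadraticForm Φ₁
  have hΦ₂c := continuous_quadraticForm Φ₂
  obtain ⟨K₁, hK₁⟩ := exists_ofReal_weightedSq_le Φ₁
  obtain ⟨K₂, hK₂⟩ := exists_setLIntegral_exp_le hA hC
  have key (u : (Fin n₁ → ℂ) → ℂ) (hu : Differentiable ℂ u) :
      ∫⁻ x, ENNReal.ofReal (weightedSq Φ₂ (pullback φ u) x) ≤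
        K₁ * K₂ * ∫⁻ y, ENNReal.ofReal (weightedSq Φ₁ u y) := by
    set W : (Fin n₁ → ℂ) → ℝ≥0∞ := fun y => ENNReal.ofReal (weightedSq Φ₁ u y)
    set E : (Fin n₂ → ℂ) → ℝ≥0∞ := fun x => ENNReal.ofReal (Real.exp (2 * (Φ₁ (φ x) - Φ₂ x)))
    have hW : Measurable W :=
      (continuous_weightedSq hΦ₁c hu.continuous).measurable.ennreal_ofReal
    have hE : Measurable E := by
      have : Continuous fun x => Real.exp (2 * (Φ₁ (φ x) - Φ₂ x)) := by fun_prop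
      exact this.measurable.ennreal_ofReal
    -- The sections of `T` are the unit ball at `φ x` and the preimage of the unit ball at `y`, as
    -- the two integrations require.
    set T : Set ((Fin n₂ → ℂ) × (Fin n₁ → ℂ)) := {p | dist (φ p.1) p.2 ≤ 1}
    have hT : MeasurableSet T :=
      (isClosed_le ((hφc.comp continuous_fst).dist continuous_snd) continuous_const).measurableSet
    have hmeas : Measurable (T.indicator fun p => E p.1 * W p.2) :=
      ((hE.comp measurable_fst).mul (hW.comp measurable_snd)).indicator hT
    have hx (x : Fin n₂ → ℂ) : ENNReal.ofReal (weightedSq Φ₂ (pullback φ u) x) ≤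
        K₁ * ∫⁻ y, T.indicator (fun p => E p.1 * W p.2) (x, y) := by
      have h1 : weightedSq Φ₂ (pullback φ u) x =
          Real.exp (2 * (Φ₁ (φ x) - Φ₂ x)) * weightedSq Φ₁ u (φ x) := by
        rw [weightedSq, weightedSq, mul_left_comm, ← Real.exp_add, pullback, Function.comp_apply]
        congr 2; ring
      have h2 : ∫⁻ y, T.indicator (fun p => E p.1 * W p.2) (x, y) =
          E x * ∫⁻ y in Metric.closedBall (φ x) 1, W y := by
        rw [← lintegral_const_mul _ hW, ← lintegral_indicator measurableSet_closedBall]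
        refine lintegral_congr fun y => ?_
        by_cases h : dist (φ x) y ≤ 1
        · rw [Set.indicator_of_mem (show (x, y) ∈ T from h),
            Set.indicator_of_mem (Metric.mem_closedBall'.2 h)]
        · rw [Set.indicator_of_notMem (show (x, y) ∉ T from h),
            Set.indicator_of_notMem (mt Metric.mem_closedBall'.1 h)]
      rw [h1, h2, ENNReal.ofReal_mul (Real.exp_pos _).le, mul_left_comm]
      exact mul_le_mul_right (hK₁ u hu (φ x)) _
    have hy (y : Fin n₁ → ℂ) :
        ∫⁻ x, T.indicator (fun p => E p.1 * W p.2) (x, y) ≤ K₂ * W y := by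
      have h2 : ∫⁻ x, T.indicator (fun p => E p.1 * W p.2) (x, y) =
          (∫⁻ x in φ ⁻¹' Metric.closedBall y 1, E x) * W y := by
        rw [← lintegral_mul_const _ hE, 
          ← lintegral_indicator (Metric.isClosed_closedBall.preimage hφc).measurableSet]
        refine lintegral_congr fun x => ?_
        by_cases h : dist (φ x) y ≤ 1
        · rw [Set.indicator_of_mem (show (x, y) ∈ T from h), Set.indicator_of_mem
            (show x ∈ φ ⁻¹' Metric.closedBall y 1 from h)]
        · rw [Set.indicator_of_notMem (show (x, y) ∉ T from h), Set.indicator_of_notMem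
            (show x ∉ φ ⁻¹' Metric.closedBall y 1 from h)]
      rw [h2]
      exact mul_le_mul_left (hK₂ y) _
    calc ∫⁻ x, ENNReal.ofReal (weightedSq Φ₂ (pullback φ u) x)
        ≤ ∫⁻ x, K₁ * ∫⁻ y, T.indicator (fun p => E p.1 * W p.2) (x, y) := lintegral_mono hx
      _ = K₁ * ∫⁻ x, ∫⁻ y, T.indicator (fun p => E p.1 * W p.2) (x, y) :=
          lintegral_const_mul' _ _ ENNReal.coe_ne_top
      _ = K₁ * ∫⁻ y, ∫⁻ x, T.indicator (fun p => E p.1 * W p.2) (x, y) := by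
          rw [lintegral_lintegral_swap (f := fun x y => T.indicator (fun p => E p.1 * W p.2) (x, y))
            hmeas.aemeasurable]
      _ ≤ K₁ * ∫⁻ y, K₂ * W y := mul_le_mul_right (lintegral_mono hy) _
      _ = _ := by rw [lintegral_const_mul _ hW, mul_assoc]
  -- `key` bounds squared norms; `k ≤ (k + 1) ^ 2` avoids a square root in the constant.
  refine ⟨fun u hu => ?_, K₁ * K₂ + 1, fun u hu => ?_⟩
  · have hd : Differentiable ℂ (pullback φ u) := hu.1.comp hφ
    refine ⟨hd, (memLp_weightedMeasure_iff hΦ₂c hd.continuous).2 ((key u hu.1).trans_lt ?_)⟩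
    exact ENNReal.mul_lt_top (ENNReal.mul_lt_top ENNReal.coe_lt_top ENNReal.coe_lt_top)
      ((memLp_weightedMeasure_iff hΦ₁c hu.1.continuous).1 hu.2)
  · have hd : Differentiable ℂ (pullback φ u) := hu.1.comp hφ
    refine (ENNReal.pow_le_pow_left_iff two_ne_zero).1 ?_
    rw [eLpNorm_weightedMeasure_sq hΦ₂c hd.continuous, mul_pow,
      eLpNorm_weightedMeasure_sq hΦ₁c hu.1.continuous]
    refine (key u hu.1).trans (mul_le_mul_left ?_ _)
    norm_cast
    nlinarith [zero_le (a := K₁ * K₂)]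

end Bargmann

/-! ### The equivalence. -/

theorem theorem1 (n₁ n₂ : ℕ)
    (Φ₁ : QuadraticForm ℝ (Fin n₁ → ℂ)) (Φ₂ : QuadraticForm ℝ (Fin n₂ → ℂ))
    (hΦ₁ : Bargmann.StrictlyPlurisubharmonic Φ₁) (hΦ₂ : Bargmann.StrictlyPlurisubharmonic Φ₂)
    (φ : (Fin n₂ → ℂ) → (Fin n₁ → ℂ)) (hφ : Differentiable ℂ φ) :
    Bargmann.PullbackIsBounded Φ₁ Φ₂ φ ↔
      ∃ (A : Matrix (Fin n₁) (Fin n₂) ℂ) (b : Fin n₁ → ℂ),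
        (∀ x, φ x = A *ᵥ x + b) ∧
        (∀ x : Fin n₂ → ℂ, x ≠ 0 → Φ₂ x ≤ 0 → A *ᵥ x ≠ 0) ∧
        MemLp (fun x => Real.exp (Φ₁ (φ x) - Φ₂ x)) ∞ (volume : Measure (Fin n₂ → ℂ)) := by
  have hcont : Continuous fun x => Φ₁ (φ x) - Φ₂ x :=
    ((Bargmann.continuous_quadraticForm Φ₁).comp hφ.continuous).sub
      (Bargmann.continuous_quadraticForm Φ₂)
  rw [Bargmann.memLp_top_exp_iff hcont]
  constructor
  · intro h
    obtain ⟨C, hC⟩ := h.exists_le hΦ₁ hφ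
    obtain ⟨D, hD⟩ := Bargmann.exists_linear_growth hΦ₁ hφ hC
    have hA (x : Fin n₂ → ℂ) :
        φ x = LinearMap.toMatrix' (fderiv ℂ φ 0).toLinearMap *ᵥ x + φ 0 := by
      rw [LinearMap.toMatrix'_mulVec, add_comm]
      exact Bargmann.eq_add_fderiv_of_linear_growth hφ hD x
    exact ⟨_, φ 0, hA, fun x hx hx0 => h.mulVec_ne_zero hΦ₁ hφ hA hx hx0, C, hC⟩
  · rintro ⟨A, b, hφA, hA, C, hC⟩
    obtain rfl : φ = fun x => A *ᵥ x + b := funext hφA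
    exact Bargmann.pullbackIsBounded_of_affine hA hC
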